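/- Let $X$ be a random vector in $\mathbb{R}^n$ whose law $\mu$ has a support that is not included in an affine hyperplane. For $\lambda, x\in\mathbb{R}^n$ put $$\Lambda_\mu(\lambda)=\log\int e^{\langle\lambda,x\rangle}\,d\mu(x)\in(-\infty,+\infty],\qquad \Lambda_\mu^*(x)=\sup_{\lambda\in\mathbb{R}^n}\{\langle\lambda,x\rangle-\Lambda_\mu(\lambda)\}\in[0,+\infty].$$ Assume that $\Lambda_\mu$ is essentially smooth: its domain $\mathcal{D}=\{\Lambda_\mu<+\infty\}$ has nonempty interior, $\Lambda_\mu$ is differentiable on $\mathrm{int}(\mathcal{D})$, and $\|\nabla\Lambda_\mu(\lambda_k)\|\to+\infty$ for every sequence $(\lambda_k)$ in $\mathrm{int}(\mathcal{D})$ that converges to a boundary point of $\mathcal{D}$. Let $f:\mathbb{R}^n\to\mathbb{R}$ be measurable and, for $s\in\mathbb{R}$, let $$\phi(s)=\inf\{\Lambda_\mu^*(y): y\in\mathbb{R}^n,\ f(y)\ge s\}\in[0,+\infty]\qquad(\inf\emptyset=+\infty).$$ Let $t,\delta>0$ and assume that $\phi$ is strictly increasing on $[t-\delta,+\infty)$ as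 long as it is finite, that is, $\phi(s)<\phi(s')$ whenever $t-\delta\le s<s'$ and $\phi(s),\phi(s')<+\infty$. Let $\kappa\in\mathbb{R}$ with $\kappa\ge\phi(t-\delta)$ be such that, with $K=\{x\in\mathbb{R}^n:\Lambda_\mu^*(x)\le\kappa\}$, $$\mathbb{P}(X\notin K)\le e^{-\phi(t-\delta)}.$$ Let $W\subset\mathbb{R}^n$ be a nonempty compact convex set such that $$f(x)-f(y)\le\sup_{\lambda\in W}\langle\lambda,x-y\rangle\qquad\text{for all }x,y\in K.$$ Let $D\in[0,+\infty]$ be the Euclidean diameter of $K$, let $L=\sup_{\lambda\in W}\|\lambda\|_{\ell^2}$, and let $\mathcal{D}_{\delta/2}\subset\mathbb{R}^n$ be a finite $\frac{\delta}{2D}$-net of $W$, that is, every point of $W$ is at Euclidean distance at most $\frac{\delta}{2D}$ from some point of $\mathcal{D}_{\delta/2}$. Then $$\log\mathbb{P}\big(f(X)\ge t\big)\le-\phi(t-\delta)+\log|\mathcal{D}_{\delta/2}|+\log\Big(\Big(\frac{\kappa LD}{\delta}\Big)\vee1\Big)+2.$$ Conventions: $\log 0=-\infty$, $\delta/(2\cdot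 0)=+\infty$, $\delta/(2\cdot\infty)=0$, $0\cdot\infty=0$. -/

import Mathlib

open MeasureTheory Set Filter Topology
open scoped ENNReal

noncomputable section

/-- Logarithmic Laplace transform `Λ_μ(l) = log ∫ exp ⟪l, x⟫ dμ(x)`, with value `+∞` where the
integral is infinite. -/
def logLaplace {n : ℕ} (μ : Measure (EuclideanSpace ℝ (Fin n)))
    (l : EuclideanSpace ℝ (Fin n)) : EReal :=
  ENNReal.log (∫⁻ x, ENNReal.ofReal (Real.exp (inner ℝ l x)) ∂μ)

/-- Legendre transform `Λ*(x) = sup_l (⟪l, x⟫ - Λ(l))` of an extended-real function. -/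
def legendreTransform {n : ℕ} (Λ : EuclideanSpace ℝ (Fin n) → EReal)
    (x : EuclideanSpace ℝ (Fin n)) : EReal :=
  ⨆ l : EuclideanSpace ℝ (Fin n), ((inner ℝ l x : ℝ) : EReal) - Λ l

/-- Effective domain of an extended-real function. -/
def effDomain {n : ℕ} (Λ : EuclideanSpace ℝ (Fin n) → EReal) :
    Set (EuclideanSpace ℝ (Fin n)) :=
  {l | Λ l < ⊤}

/-- Essential smoothness of a (convex, nowhere `-∞`) function `Λ : ℝⁿ → ℝ ∪ {+∞}`: its domain has
nonempty interior, `Λ` is differentiable there, and it is steep. -/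
structure EssentiallySmooth {n : ℕ} (Λ : EuclideanSpace ℝ (Fin n) → EReal) : Prop where
  interior_nonempty : (interior (effDomain Λ)).Nonempty
  differentiableAt : ∀ l ∈ interior (effDomain Λ), DifferentiableAt ℝ (fun v => (Λ v).toReal) l
  steep : ∀ u : ℕ → EuclideanSpace ℝ (Fin n), (∀ k, u k ∈ interior (effDomain Λ)) →
    ∀ p ∈ frontier (effDomain Λ), Tendsto u atTop (𝓝 p) →
      Tendsto (fun k => ‖gradient (fun v => (Λ v).toReal) (u k)‖) atTop atTop

/-- The support of `μ` is not included in an (affine) hyperplane. -/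
def NotInHyperplane {n : ℕ} (μ : Measure (EuclideanSpace ℝ (Fin n))) : Prop :=
  ∀ (v : EuclideanSpace ℝ (Fin n)) (c : ℝ), v ≠ 0 → ¬ μ.support ⊆ {x | inner ℝ v x = c}

/-- Upper-tail rate `φ(s) = inf {Λ*(y) : f(y) ≥ s}`, equal to `+∞` if no `y` has `f(y) ≥ s`. -/
def upperRate {n : ℕ} (μ : Measure (EuclideanSpace ℝ (Fin n)))
    (f : EuclideanSpace ℝ (Fin n) → ℝ) (s : ℝ) : EReal :=
  ⨅ (y : EuclideanSpace ℝ (Fin n)) (_ : s ≤ f y), legendreTransform (logLaplace μ) y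

/-- The sublevel set `{Λ* ≤ κ}`. -/
def rateSublevel {n : ℕ} (μ : Measure (EuclideanSpace ℝ (Fin n))) (κ : ℝ) :
    Set (EuclideanSpace ℝ (Fin n)) :=
  {x | legendreTransform (logLaplace μ) x ≤ (κ : EReal)}

/-- Support function `h_W(z) = sup_{w ∈ W} ⟪w, z⟫`; used for nonempty compact `W` only. -/
def supportFun {n : ℕ} (W : Set (EuclideanSpace ℝ (Fin n)))
    (z : EuclideanSpace ℝ (Fin n)) : ℝ :=
  sSup ((fun w => (inner ℝ w z : ℝ)) '' W)

/-- The finite set `N` is an `ε`-net of `W`: each point of `W` is within `ε` of a point of `N`.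
The points of `N` need not lie in `W`. -/
def IsNet {n : ℕ} (ε : ℝ≥0∞) (W : Set (EuclideanSpace ℝ (Fin n)))
    (N : Finset (EuclideanSpace ℝ (Fin n))) : Prop :=
  ∀ w ∈ W, ∃ d ∈ N, edist w d ≤ ε

end

/-! Put r = φ(t - δ). The set S = {Λ* < r} is convex, lies in K, and f < t - δ on it. If x ∈ K and
f(x) ≥ t, then h_W(x - y) ≥ δ for every y ∈ S, and a minimax argument
(`exists_forall_le_inner_of_le_supportFun`) makes one w ∈ W serve all y at once. Moving w to a net
point d costs δ/2, so x lies in a closed convex set H d that still misses S. On H d one has Λ* ≥ r.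
Conditional means stay in a closed convex set, and by Jensen their rate is at most minus the log of
its mass, so H d has mass at most e^{-r} with no prefactor (`measure_le_exp_neg_of_closed_convex`).
A union bound over the net and the complement of K concludes. -/

/-- If `μ` is a probability measure, the conditional mean `y` of `μ` on a bounded set `A` of positive
measure satisfies `Λ*(y) ≤ -log μ(A)`. -/
theorem legendreTransform_setAverage_le {n : ℕ} (μ : Measure (EuclideanSpace ℝ (Fin n)))
    [IsProbabilityMeasure μ] {A : Set (EuclideanSpace ℝ (Fin n))}
    (hA : Bornology.IsBounded A) (h0 : μ A ≠ 0) :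
    legendreTransform (logLaplace μ) (⨍ x in A, x ∂μ) ≤ -ENNReal.log (μ A) := by
  set y := ⨍ x in A, x ∂μ
  obtain ⟨R, hR⟩ := hA.subset_closedBall 0
  have hmem : ∀ᵐ x ∂μ.restrict A, x ∈ Metric.closedBall (0 : EuclideanSpace ℝ (Fin n)) R :=
    ae_restrict_of_ae_restrict_of_subset hR (ae_restrict_mem Metric.isClosed_closedBall.measurableSet)
  have hbdd : ∀ {E : Type} [NormedAddCommGroup E] [SecondCountableTopology E]
      [MeasurableSpace E] [BorelSpace E]
      (g : EuclideanSpace ℝ (Fin n) → E), Continuous g → IntegrableOn g A μ := by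
    intro E _ _ _ _ g hg
    obtain ⟨C, hC⟩ := (isCompact_closedBall (0 : EuclideanSpace ℝ (Fin n)) R).exists_bound_of_continuousOn
      hg.continuousOn
    exact Integrable.of_bound hg.aestronglyMeasurable C (hmem.mono fun x hx => hC x hx)
  refine iSup_le fun l => ?_
  have hlin : inner ℝ l y = ⨍ x in A, inner ℝ l x ∂μ := by
    simp only [y, setAverage_eq, inner_smul_right, smul_eq_mul]
    rw [← integral_inner (f := fun x => x) (hbdd _ continuous_id)]
  have hjensen : Real.exp (inner ℝ l y) ≤ ⨍ x in A, Real.exp (inner ℝ l x) ∂μ := by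
    rw [hlin]
    exact convexOn_exp.map_set_average_le Real.continuous_exp.continuousOn isClosed_univ h0
      (measure_ne_top _ _) (by simp) (hbdd _ (by fun_prop)) (hbdd _ (by fun_prop))
  have hpos : 0 < μ.real A := ENNReal.toReal_pos h0 (measure_ne_top _ _)
  have hlower : μ A * ENNReal.ofReal (Real.exp (inner ℝ l y)) ≤
      ∫⁻ x, ENNReal.ofReal (Real.exp (inner ℝ l x)) ∂μ := by
    calc μ A * ENNReal.ofReal (Real.exp (inner ℝ l y))
        = ENNReal.ofReal (μ.real A * Real.exp (inner ℝ l y)) := by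
          rw [ENNReal.ofReal_mul hpos.le, ofReal_measureReal]
      _ ≤ ENNReal.ofReal (∫ x in A, Real.exp (inner ℝ l x) ∂μ) := by
          apply ENNReal.ofReal_le_ofReal
          rw [setAverage_eq, smul_eq_mul] at hjensen
          rwa [← le_inv_mul_iff₀ hpos]
      _ = ∫⁻ x in A, ENNReal.ofReal (Real.exp (inner ℝ l x)) ∂μ :=
          ofReal_integral_eq_lintegral_ofReal (hbdd _ (by fun_prop))
            (ae_of_all _ fun _ => (Real.exp_pos _).le)
      _ ≤ _ := setLIntegral_le_lintegral _ _
  have hlog := ENNReal.log_monotone hlower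
  rw [ENNReal.log_mul_add, ENNReal.log_ofReal_of_pos (Real.exp_pos _), Real.log_exp,
    ENNReal.log_pos_real h0 (measure_ne_top _ _)] at hlog
  rw [ENNReal.log_pos_real h0 (measure_ne_top _ _)]
  change _ - ENNReal.log _ ≤ _
  -- The log-Laplace value may be `⊤`, where the bound is trivial; `hlog` bounds it below by a real,
  -- which excludes `⊥`.
  generalize ENNReal.log (∫⁻ x, ENNReal.ofReal (Real.exp (inner ℝ l x)) ∂μ) = b at hlog
  induction b with
  | bot => simp [← EReal.coe_add] at hlog
  | top => simp
  | coe b => norm_cast at hlog ⊢; linarith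

/-- Large deviation upper bound for closed convex sets. -/
theorem measure_le_exp_neg_of_closed_convex {n : ℕ} (μ : Measure (EuclideanSpace ℝ (Fin n)))
    [IsProbabilityMeasure μ] {C : Set (EuclideanSpace ℝ (Fin n))} (hC : IsClosed C)
    (hconv : Convex ℝ C) {r : EReal} (hr : ∀ y ∈ C, r ≤ legendreTransform (logLaplace μ) y) :
    μ C ≤ EReal.exp (-r) := by
  -- Exhausting by balls makes the conditional mean exist without any moment assumption.
  have hmono : Monotone fun k : ℕ => C ∩ Metric.closedBall 0 (k : ℝ) := fun a b hab =>
    inter_subset_inter_right _ (Metric.closedBall_subset_closedBall (by exact_mod_cast hab))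
  rw [← Metric.iUnion_inter_closedBall_nat C 0, hmono.measure_iUnion]
  refine iSup_le fun k => ?_
  set A := C ∩ Metric.closedBall 0 (k : ℝ)
  by_cases h0 : μ A = 0
  · simp [h0]
  have hbdd : Bornology.IsBounded A := Metric.isBounded_closedBall.subset inter_subset_right
  have hAm : MeasurableSet A := (hC.inter Metric.isClosed_closedBall).measurableSet
  have hmean : (⨍ x in A, x ∂μ) ∈ C := by
    refine hconv.set_average_mem hC h0 (measure_ne_top _ _)
      ((ae_restrict_mem hAm).mono fun _ hx => hx.1) ?_
    exact Integrable.of_bound aestronglyMeasurable_id k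
      ((ae_restrict_mem hAm).mono fun x hx => by simpa using hx.2)
  have h := (hr _ hmean).trans (legendreTransform_setAverage_le μ hbdd h0)
  rw [← ENNReal.log_le_log_iff, EReal.log_exp]
  exact EReal.le_neg_of_le_neg h

/-- The strict sublevel sets of a Legendre transform are convex. -/
theorem convex_legendreTransform_lt {n : ℕ} (Λ : EuclideanSpace ℝ (Fin n) → EReal) (r : EReal) :
    Convex ℝ {y | legendreTransform Λ y < r} := by
  intro x hx y hy a b ha hb hab
  have hxy : max (legendreTransform Λ x) (legendreTransform Λ y) < r := max_lt hx hy
  refine (iSup_le fun l => ?_ : legendreTransform Λ _ ≤ _).trans_lt hxy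
  have hinner : (inner ℝ l (a • x + b • y) : ℝ) ≤ max (inner ℝ l x) (inner ℝ l y) := by
    rw [inner_add_right, inner_smul_right, inner_smul_right]
    exact Convex.combo_le_max _ _ ha hb hab
  rcases max_choice (inner ℝ l x : ℝ) (inner ℝ l y) with h | h <;> rw [h] at hinner
  · exact (EReal.sub_le_sub (EReal.coe_le_coe_iff.2 hinner) le_rfl).trans
      ((le_iSup (fun l => ((inner ℝ l x : ℝ) : EReal) - Λ l) l).trans (le_max_left _ _))
  · exact (EReal.sub_le_sub (EReal.coe_le_coe_iff.2 hinner) le_rfl).trans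
      ((le_iSup (fun l => ((inner ℝ l y : ℝ) : EReal) - Λ l) l).trans (le_max_right _ _))

/-- If the support function of a compact convex `W` is at least `c` on `x - S` with `S` convex, then
one point of `W` witnesses this simultaneously for all points of `S`. -/
theorem exists_forall_le_inner_of_le_supportFun {n : ℕ} {W S : Set (EuclideanSpace ℝ (Fin n))}
    (hWne : W.Nonempty) (hW : IsCompact W) (hWconv : Convex ℝ W) (hS : Convex ℝ S)
    (x : EuclideanSpace ℝ (Fin n)) {c : ℝ} (h : ∀ y ∈ S, c ≤ supportFun W (x - y)) :
    ∃ w ∈ W, ∀ y ∈ S, c ≤ inner ℝ w (x - y) := by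
  by_contra! hcon
  -- S need not be compact: compactness of W leaves finitely many y that defeat every w, which is
  -- what the finite form of Sion's theorem needs to yield a single such y.
  obtain ⟨s, hsS, hs, hcover⟩ := hW.elim_finite_subcover_image (b := S)
    (c := fun y => {w | inner ℝ w (x - y) < c})
    (fun y _ => isOpen_lt (by fun_prop) continuous_const)
    (fun w hw => by simpa using hcon w hw)
  obtain ⟨y, hyS, hy⟩ := Sion.exists_lt_iInf_of_lt_iInf_of_finite
    (X := W) (Y := S) (f := fun w y => (inner ℝ w (y - x) : ℝ)) (t := -c)
    hWne hW
    (fun y _ => (Continuous.lowerSemicontinuous (by fun_prop)).lowerSemicontinuousOn _)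
    (fun y _ => by
      refine ConvexOn.quasiconvexOn ⟨hWconv, fun u _ v _ a b _ _ _ => le_of_eq ?_⟩
      simp only [inner_add_left, real_inner_smul_left, smul_eq_mul])
    hS
    (fun w _ => (Continuous.upperSemicontinuous (by fun_prop)).upperSemicontinuousOn _)
    (fun w _ => by
      refine ConcaveOn.quasiconcaveOn ⟨hS, fun u _ v _ a b _ _ hab => le_of_eq ?_⟩
      simp only [inner_sub_right, inner_add_right, real_inner_smul_right, smul_eq_mul]
      linear_combination (-inner ℝ w x) * hab)
    hWconv hs hsS
    (fun w hw => by
      obtain ⟨y, hy, hwy⟩ := mem_iUnion₂.1 (hcover hw)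
      refine ⟨y, hy, ?_⟩
      rw [← neg_sub x y, inner_neg_right]
      exact neg_lt_neg hwy)
  -- Attainment keeps the inequality strict when passing to the supremum.
  obtain ⟨w, hw, hmax⟩ := hW.exists_sSup_image_eq (f := fun w => (inner ℝ w (x - y) : ℝ)) hWne
    (by fun_prop)
  have h1 := h y hyS
  have h2 := hy w hw
  rw [supportFun, hmax] at h1
  rw [← neg_sub x y, inner_neg_right] at h2
  linarith

/-- Replacing `w` by a point at distance at most `δ / (2 D)` changes its pairing with a vector of
length at most `D` by at most `δ / 2`. -/
theorem inner_sub_half_le_of_edist_le {n : ℕ} {w d z : EuclideanSpace ℝ (Fin n)} {δ : ℝ}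
    (hδ : 0 < δ) {D : ℝ≥0∞} (hz : ‖z‖ₑ ≤ D) (hd : edist w d ≤ ENNReal.ofReal δ / (2 * D)) :
    inner ℝ w z - δ / 2 ≤ inner ℝ d z := by
  -- This case absorbs D = 0, where the net radius is infinite. For D = ∞ the radius is 0, which
  -- forces w = d.
  by_cases hz0 : z = 0
  · simpa [hz0] using (half_pos hδ).le
  have hDpos : D ≠ 0 := fun h => hz0 (by simpa [h] using hz)
  by_cases hDtop : D = ⊤
  · have : w = d := by simpa [hDtop] using hd
    rw [this]; linarith
  lift D to NNReal using hDtop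
  have hD0 : (0 : ℝ) < D := by
    exact_mod_cast pos_iff_ne_zero.2 (by exact_mod_cast hDpos)
  have hz' : ‖z‖ ≤ D := by
    rw [← ofReal_norm, ENNReal.ofReal_le_iff_le_toReal ENNReal.coe_ne_top] at hz
    simpa using hz
  have hd' : ‖w - d‖ ≤ δ / (2 * D) := by
    have h2 : (2 * (D : ℝ≥0∞)) = ENNReal.ofReal (2 * D) := by
      rw [ENNReal.ofReal_mul (by norm_num)]; simp
    rw [h2, ← ENNReal.ofReal_div_of_pos (by positivity), edist_dist,
      ENNReal.ofReal_le_ofReal_iff (by positivity), dist_eq_norm] at hd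
    exact hd
  have := calc inner ℝ (w - d) z ≤ ‖w - d‖ * ‖z‖ := real_inner_le_norm _ _
    _ ≤ δ / (2 * D) * D := by gcongr
    _ = δ / 2 := by field_simp
  rw [inner_sub_left] at this
  linarith

theorem mainTheorem8 {n : ℕ} {Ω : Type*} [MeasurableSpace Ω] (P : Measure Ω)
    [IsProbabilityMeasure P] (X : Ω → EuclideanSpace ℝ (Fin n)) (hX : AEMeasurable X P)
    (μ : Measure (EuclideanSpace ℝ (Fin n))) (hμ : μ = P.map X)
    (hplane : NotInHyperplane μ) (hsmooth : EssentiallySmooth (logLaplace μ))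
    (f : EuclideanSpace ℝ (Fin n) → ℝ) (hf : Measurable f)
    (t δ : ℝ) (ht : 0 < t) (hδ : 0 < δ)
    (hφ : StrictMonoOn (upperRate μ f) {s | t - δ ≤ s ∧ upperRate μ f s < ⊤})
    (κ : ℝ) (hκ : upperRate μ f (t - δ) ≤ (κ : EReal))
    (htight : P {ω | X ω ∉ rateSublevel μ κ} ≤ EReal.exp (-upperRate μ f (t - δ)))
    (W : Set (EuclideanSpace ℝ (Fin n))) (hWne : W.Nonempty) (hWcomp : IsCompact W)
    (hWconv : Convex ℝ W)
    (hW : ∀ x ∈ rateSublevel μ κ, ∀ y ∈ rateSublevel μ κ, f x - f y ≤ supportFun W (x - y))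
    (D : ℝ≥0∞) (hD : D = Metric.ediam (rateSublevel μ κ))
    (L : ℝ≥0∞) (hL : L = ⨆ w ∈ W, ‖w‖ₑ)
    (N : Finset (EuclideanSpace ℝ (Fin n))) (hN : IsNet (ENNReal.ofReal δ / (2 * D)) W N) :
    ENNReal.log (P {ω | t ≤ f (X ω)}) ≤
      -upperRate μ f (t - δ) + ENNReal.log (N.card : ℝ≥0∞)
        + ENNReal.log (max (ENNReal.ofReal κ * L * D / ENNReal.ofReal δ) 1) + 2 := by
  have hXlaw : IsProbabilityMeasure μ := hμ ▸ Measure.isProbabilityMeasure_map hX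
  set r := upperRate μ f (t - δ)
  set K := rateSublevel μ κ
  -- Strictness matters: a point with Λ* = r may have f ≥ t - δ.
  set S := {y | legendreTransform (logLaplace μ) y < r}
  have hSconv : Convex ℝ S := convex_legendreTransform_lt _ _
  have hSK : S ⊆ K := fun y hy => (le_of_lt hy).trans hκ
  have hSf : ∀ y ∈ S, f y < t - δ := fun y hy => by
    by_contra! hle
    have hr : r ≤ legendreTransform (logLaplace μ) y := iInf₂_le y hle
    exact not_lt_of_ge hr hy
  -- The margin δ/2 is what remains of δ after the net approximation; being positive, it keeps `H d`
  -- disjoint from S.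
  let H (d : EuclideanSpace ℝ (Fin n)) : Set (EuclideanSpace ℝ (Fin n)) :=
    ⋂ y ∈ S, {x | δ / 2 + inner ℝ d y ≤ inner ℝ d x}
  have hHclosed (d) : IsClosed (H d) :=
    isClosed_biInter fun y _ => isClosed_le continuous_const (by fun_prop)
  have hHconv (d) : Convex ℝ (H d) :=
    convex_iInter₂ fun y _ => convex_halfSpace_ge (innerₛₗ ℝ d).isLinear _
  have hHrate (d) : ∀ y ∈ H d, r ≤ legendreTransform (logLaplace μ) y := fun y hy => by
    by_contra! hlt
    have : δ / 2 + inner ℝ d y ≤ inner ℝ d y := mem_iInter₂.1 hy y hlt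
    linarith
  have hHmeas (d) : P (X ⁻¹' H d) ≤ EReal.exp (-r) := by
    rw [← Measure.map_apply_of_aemeasurable hX (hHclosed d).measurableSet, ← hμ]
    exact measure_le_exp_neg_of_closed_convex μ (hHclosed d) (hHconv d) (hHrate d)
  have hsub : {ω | t ≤ f (X ω)} ⊆ {ω | X ω ∉ K} ∪ ⋃ d ∈ N, X ⁻¹' H d := by
    intro ω hω
    by_cases hK : X ω ∈ K
    · obtain ⟨w, hwW, hw⟩ := exists_forall_le_inner_of_le_supportFun hWne hWcomp hWconv hSconv
        (X ω) (c := δ) fun y hy => by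
          have h1 := hW _ hK y (hSK hy)
          have h2 := hSf y hy
          have h3 : t ≤ f (X ω) := hω
          linarith
      obtain ⟨d, hdN, hd⟩ := hN w hwW
      refine Or.inr (mem_iUnion₂.2 ⟨d, hdN, mem_iInter₂.2 fun y hy => ?_⟩)
      have hdist : ‖X ω - y‖ₑ ≤ D := by
        rw [hD, ← edist_eq_enorm_sub]
        exact Metric.edist_le_ediam_of_mem hK (hSK hy)
      have h1 := inner_sub_half_le_of_edist_le hδ hdist hd
      have h2 := hw y hy
      rw [inner_sub_right d] at h1
      rw [mem_ofPred_eq]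
      linarith
    · exact Or.inl hK
  -- A nonempty net lets 1 + |N| ≤ 2|N| absorb the mass outside K; the factor 2 is then covered by
  -- e².
  have hcard : 1 ≤ (N.card : ℝ≥0∞) := by
    obtain ⟨w, hw⟩ := hWne
    obtain ⟨d, hd, -⟩ := hN w hw
    exact_mod_cast Finset.card_pos.2 ⟨d, hd⟩
  have htwo : (2 : ℝ≥0∞) ≤ EReal.exp 2 := by
    have h : (2 : EReal) = ((2 : ℝ) : EReal) := rfl
    rw [h, EReal.exp_coe, ← ENNReal.ofReal_ofNat]
    exact ENNReal.ofReal_le_ofReal (by linarith [Real.add_one_le_exp 2])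
  have hbound : P {ω | t ≤ f (X ω)} ≤ EReal.exp (-r) * N.card * EReal.exp 2 := calc
    P {ω | t ≤ f (X ω)} ≤ P {ω | X ω ∉ K} + ∑ d ∈ N, P (X ⁻¹' H d) :=
      (measure_mono hsub).trans ((measure_union_le _ _).trans
        (by gcongr; exact measure_biUnion_finset_le _ _))
    _ ≤ EReal.exp (-r) + ∑ _d ∈ N, EReal.exp (-r) := by
      gcongr with d
      exact hHmeas d
    _ = EReal.exp (-r) * (1 + N.card) := by
      rw [Finset.sum_const, nsmul_eq_mul]; ring
    _ ≤ EReal.exp (-r) * (N.card * 2) := by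
      rw [mul_two]; gcongr
    _ ≤ EReal.exp (-r) * N.card * EReal.exp 2 := by
      rw [← mul_assoc]; gcongr
  calc ENNReal.log (P {ω | t ≤ f (X ω)})
      ≤ ENNReal.log (EReal.exp (-r) * N.card * EReal.exp 2) := ENNReal.log_monotone hbound
    _ = -r + ENNReal.log N.card + 0 + 2 := by
      rw [ENNReal.log_mul_add, ENNReal.log_mul_add, EReal.log_exp, EReal.log_exp, add_zero]
    -- The κLD/δ term is a logarithm of a number at least 1, so it can replace the 0.
    _ ≤ _ := by
      gcongr
      exact ENNReal.zero_le_log_iff.2 (le_max_right _ _)
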